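/- Let $\mathbf{k}$ be a commutative unital ring, $\lambda\in\mathbf{k}$, and $X$ a set. Algebras are unital, associative $\mathbf{k}$-algebras, not necessarily commutative. A Rota--Baxter algebra of weight $\lambda$ is an algebra $R$ with a linear operator $P:R\to R$ such that $P(a)P(b)=P\big(P(a)b+aP(b)+\lambda ab\big)$ for all $a,b\in R$. Let $\mathcal{T}(X)$ be the set of angularly $X$-decorated planar rooted trees (the case of a trivial semigroup $\Omega$, where the internal edges carry no information): an element $T$ is a planar rooted tree with at least one vertex, whose root vertex has $n+1\ge 1$ branches $T_1,\dots,T_{n+1}$ in order from left to right, where each $T_i$ is either a leaf $|$ or again an element of $\mathcal{T}(X)$, and whose $n$ angles between adjacent branches are decorated by $x_1,\dots,x_n\in X$. Write $T=[T_1,x_1,T_2,\dots,x_n,T_{n+1}]$, and put $\bullet=[\,|\,]$, $j_X(x)=[\,|,x,|\,]$ and $B^+(T)=[T]$. Let $\mathbf{k}\mathcal{T}(X)$ be the free $\mathbf{k}$-module on $\mathcal{T}(X)$, and extend $B^+$ linearly. The bilinear product $\diamond$ on $\mathbf{k}\mathcal{T}(X)$ is defined on trees $T=[T_1,x_1,\dots,x_m,T_{m+1}]$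 and $T'=[T'_1,y_1,\dots,y_n,T'_{n+1}]$ by induction on the sum of their depths: * if $T'_1=|$, then $T\diamond T'=[T_1,x_1,\dots,x_m,T_{m+1},y_1,T'_2,\dots,y_n,T'_{n+1}]$; * if $T_{m+1}=|$, then $T\diamond T'=[T_1,x_1,\dots,x_m,T'_1,y_1,T'_2,\dots,y_n,T'_{n+1}]$; * if $T_{m+1}\ne|$ and $T'_1\ne|$, then $T\diamond T'=\sum_U c_U\,[T_1,x_1,\dots,x_m,U,y_1,T'_2,\dots,y_n,T'_{n+1}]$, where $\sum_U c_U\,U=B^+(T_{m+1})\diamond T'_1+T_{m+1}\diamond B^+(T'_1)+\lambda\,T_{m+1}\diamond T'_1$ with $U\in\mathcal{T}(X)$. Then $(\mathbf{k}\mathcal{T}(X),\diamond,B^+)$ with unit $\bullet$ and the map $j_X:X\to\mathbf{k}\mathcal{T}(X)$ is the free Rota--Baxter algebra of weight $\lambda$ on $X$. That is, it is a Rota--Baxter algebra of weight $\lambda$, and for every Rota--Baxter algebra $(R,P)$ of weight $\lambda$ and every map $f:X\to R$ there is a unique unital algebra homomorphism $\varphi:\mathbf{k}\mathcal{T}(X)\to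 R$ with $\varphi\circ B^+=P\circ\varphi$ and $\varphi\circ j_X=f$. -/

import Mathlib

universe u v w z

/- Angularly `X`-decorated planar rooted trees.  The root and the leaves are edges, every vertex has
at least one incoming edge, and each angle between two adjacent incoming edges of a vertex carries
an element of `X`. -/

mutual

/-- A planar rooted tree with at least one vertex, given by the incoming edges of its lowest
vertex, read from left to right and separated by the decorations of the angles between them:
`cons b₁ x₁ (cons b₂ x₂ (… (cons bₙ xₙ (last bₙ₊₁))))` is the tree with branches
`b₁, …, bₙ₊₁` and angle decorations `x₁, …, xₙ`, where `n ≥ 0`. -/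
inductive AngTree (X : Type v) : Type v where
  | last (b : AngBranch X) : AngTree X
  | cons (b : AngBranch X) (x : X) (T : AngTree X) : AngTree X

/-- An incoming edge of a vertex with what sits on top of it: either it is a leaf, that is the
tree `|` without vertices, or it is an internal edge that carries a tree. -/
inductive AngBranch (X : Type v) : Type v where
  | leaf : AngBranch X
  | edge (T : AngTree X) : AngBranch X

end

mutual

/-- The maximal length of a chain from the root to a leaf. -/
def AngTree.depth {X : Type*} : AngTree X → ℕ
  | .last b => b.depth + 1
  | .cons b _ T => max (b.depth + 1) T.depth

/-- The depth of a branch; the tree `|` has depth `0`. -/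
def AngBranch.depth {X : Type*} : AngBranch X → ℕ
  | .leaf => 0
  | .edge T => T.depth

end

namespace AngTree

/-- The tree `•` with one vertex and one leaf. -/
def dot {X : Type*} : AngTree X := last .leaf

/-- The tree with one vertex, two leaves, and one angle, which is decorated by `x`. -/
def corolla {X : Type*} (x : X) : AngTree X := cons .leaf x (last .leaf)

/-- The grafting `B⁺(T)`: a new root vertex whose only incoming edge carries `T`. -/
def graft {X : Type*} (T : AngTree X) : AngTree X := last (.edge T)

/-- The leftmost branch `T₁` of `T`. -/
def firstBranch {X : Type*} : AngTree X → AngBranch X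
  | last b => b
  | cons b _ _ => b

/-- The rightmost branch `Tₙ₊₁` of `T`. -/
def lastBranch {X : Type*} : AngTree X → AngBranch X
  | last b => b
  | cons _ _ T => T.lastBranch

/-- Replace the leftmost branch of a tree by `b`. -/
def setFirst {X : Type*} (b : AngBranch X) : AngTree X → AngTree X
  | last _ => last b
  | cons _ x T => cons b x T

/-- For `T` with branches `T₁, …, Tₘ₊₁` and angles `x₁, …, xₘ`, and `T'` with branches
`T'₁, …, T'ₙ₊₁` and angles `y₁, …, yₙ`, the tree with branches `T₁, …, Tₘ, b, T'₂, …, T'ₙ₊₁` and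
angles `x₁, …, xₘ, y₁, …, yₙ`. -/
def join {X : Type*} : AngTree X → AngBranch X → AngTree X → AngTree X
  | last _, b, T' => T'.setFirst b
  | cons c x T, b, T' => cons c x (join T b T')

theorem depth_firstBranch_lt {X : Type*} (T : AngTree X) : T.firstBranch.depth < T.depth := by
  cases T <;> simp [firstBranch, depth]

theorem depth_lastBranch_lt {X : Type*} : (T : AngTree X) → T.lastBranch.depth < T.depth
  | last b => by simp [lastBranch, depth]
  | cons b x T => by
      have h := depth_lastBranch_lt T
      simp only [lastBranch, depth]
      exact lt_max_of_lt_right h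

/-- The product `T ⋄ T'` of two trees, by induction on `T.depth + T'.depth`.  If the rightmost
branch of `T` or the leftmost branch of `T'` is a leaf, the lowest vertices of `T` and `T'` are
merged, and so are these two branches.  If they are internal edges that carry trees `S` and `S'`,
their place is taken by `B⁺(S) ⋄ B⁺(S') = B⁺(B⁺(S) ⋄ S' + S ⋄ B⁺(S') + lam • (S ⋄ S'))`. -/
noncomputable def diamond {X k : Type*} [CommRing k] (lam : k) (T T' : AngTree X) :
    AngTree X →₀ k :=
  match h : T.lastBranch, h' : T'.firstBranch with
  | .leaf, b => Finsupp.single (join T b T') 1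
  | .edge S, .leaf => Finsupp.single (join T (.edge S) T') 1
  | .edge S, .edge S' =>
      Finsupp.mapDomain (fun U => join T (.edge U) T')
        (diamond lam S.graft S' + diamond lam S S'.graft + lam • diamond lam S S')
termination_by T.depth + T'.depth
decreasing_by
  all_goals
    have h1 := depth_lastBranch_lt T
    have h2 := depth_firstBranch_lt T'
    rw [h] at h1
    rw [h'] at h2
    simp only [graft, depth, AngBranch.depth] at h1 h2 ⊢
    omega

/- In the last case `B⁺(S) ⋄ B⁺(S')` is a sum of trees `B⁺(U)`; the product of `T`, with its
rightmost branch replaced by `|`, with `B⁺(U)` and then with `T'`, with its leftmost branch replaced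
by `|`, only merges lowest vertices and is the tree `join T (.edge U) T'`. -/

/-- The bilinear extension of `⋄` to the free module `k 𝒯(X)` on the set of trees. -/
noncomputable def mulHom {k : Type*} [CommRing k] (X : Type*) (lam : k) :
    (AngTree X →₀ k) →ₗ[k] (AngTree X →₀ k) →ₗ[k] (AngTree X →₀ k) :=
  Finsupp.linearCombination k fun T : AngTree X =>
    Finsupp.linearCombination k fun T' : AngTree X => diamond lam T T'

/-- The linear extension of the grafting operator `B⁺` to `k 𝒯(X)`. -/
noncomputable def graftHom (k : Type*) [CommRing k] (X : Type*) :
    (AngTree X →₀ k) →ₗ[k] (AngTree X →₀ k) :=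
  Finsupp.lmapDomain k k graft

/-- The map `j_X : X → k 𝒯(X)`, which sends `x` to the corolla decorated by `x`. -/
noncomputable def gen (k : Type*) [CommRing k] {X : Type*} (x : X) : AngTree X →₀ k :=
  Finsupp.single (corolla x) 1

/-- The unit `•` of `k 𝒯(X)`. -/
noncomputable def unit (k : Type*) [CommRing k] (X : Type*) : AngTree X →₀ k :=
  Finsupp.single dot 1

end AngTree

/-- `P` is a Rota–Baxter operator of weight `lam` for the bilinear product `mul`. -/
def IsRotaBaxterOperator {k A : Type*} [CommRing k] [AddCommGroup A] [Module k A]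
    (lam : k) (mul : A →ₗ[k] A →ₗ[k] A) (P : A →ₗ[k] A) : Prop :=
  ∀ a b : A, mul (P a) (P b) = P (mul (P a) b + mul a (P b) + lam • mul a b)

/-- The `k`-module `A` with the bilinear product `mul`, the element `one`, and the linear operator
`P` is a unital associative Rota–Baxter algebra of weight `lam`, and it is free on the set `X` with
respect to the map `j : X → A` (tested against Rota–Baxter algebras in the universe `w`). -/
structure IsFreeRotaBaxterAlgebra {k : Type u} {X : Type v} {A : Type z} [CommRing k]
    [AddCommGroup A] [Module k A] (lam : k) (mul : A →ₗ[k] A →ₗ[k] A) (one : A)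
    (P : A →ₗ[k] A) (j : X → A) : Prop where
  mul_assoc : ∀ a b c : A, mul (mul a b) c = mul a (mul b c)
  one_mul : ∀ a : A, mul one a = a
  mul_one : ∀ a : A, mul a one = a
  rotaBaxter : IsRotaBaxterOperator lam mul P
  existsUnique_hom : ∀ (R : Type w) [Ring R] [Algebra k R] (Q : R →ₗ[k] R),
    IsRotaBaxterOperator lam (LinearMap.mul k R) Q → ∀ f : X → R,
      ∃! φ : A →ₗ[k] R, φ one = 1 ∧ (∀ a b : A, φ (mul a b) = φ a * φ b) ∧
        (∀ a : A, φ (P a) = Q (φ a)) ∧ ∀ x : X, φ (j x) = f x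

-- A tree with several branches is its one-branch pieces, each `•` or a graft `B⁺(S)`, multiplied
-- together with the generators of its angles in between: `append T x U` is `T ⋄ j(x) ⋄ U`
-- (`mulHom_mulHom_gen`). The product acts only where two trees meet, so concatenation moves out of
-- either factor (`mulHom_appendHom_left`, `mulHom_appendHom_right`). Associativity and
-- multiplicativity of the evaluation map thus reduce to one-branch trees. There `•` is the unit,
-- and for grafts the Rota–Baxter identity, which is the recursive clause of `⋄`, allows induction
-- on size (`mulHom_assoc_single`, `lift_mulHom_single`). The same decomposition forces the value of
-- a homomorphism on every tree (`hom_single_eq_eval`).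

namespace AngTree

/-- The tree with branches `T₁, …, Tₘ₊₁, T'₁, …, T'ₙ₊₁` and angles `x₁, …, xₘ, x, y₁, …, yₙ`, for
`T` with branches `T₁, …, Tₘ₊₁` and angles `x₁, …, xₘ`, and `T'` with branches `T'₁, …, T'ₙ₊₁` and
angles `y₁, …, yₙ`. -/
def append {X : Type*} : AngTree X → X → AngTree X → AngTree X
  | last b, x, V => cons b x V
  | cons b y T, x, V => cons b y (append T x V)

-- Concatenation of trees

section Append

variable {X : Type*}

theorem lastBranch_append (T : AngTree X) (x : X) (U : AngTree X) :
    (append T x U).lastBranch = U.lastBranch :=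
  match T with
  | last _ => rfl
  | cons _ _ T => lastBranch_append T x U

theorem firstBranch_append (T : AngTree X) (x : X) (U : AngTree X) :
    (append T x U).firstBranch = T.firstBranch := by
  cases T <;> rfl

theorem setFirst_append (b : AngBranch X) (T : AngTree X) (x : X) (U : AngTree X) :
    (append T x U).setFirst b = append (T.setFirst b) x U := by
  cases T <;> rfl

theorem join_append_left (T : AngTree X) (x : X) (U : AngTree X) (b : AngBranch X)
    (V : AngTree X) : join (append T x U) b V = append T x (join U b V) :=
  match T with
  | last _ => rfl
  | cons c y T => congrArg (cons c y) (join_append_left T x U b V)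

theorem join_append_right (T : AngTree X) (b : AngBranch X) (U : AngTree X) (x : X)
    (V : AngTree X) : join T b (append U x V) = append (join T b U) x V :=
  match T with
  | last _ => setFirst_append b U x V
  | cons c y T => congrArg (cons c y) (join_append_right T b U x V)

theorem setFirst_firstBranch (T : AngTree X) : T.setFirst T.firstBranch = T := by
  cases T <;> rfl

theorem join_lastBranch_dot (T : AngTree X) : join T T.lastBranch dot = T :=
  match T with
  | last _ => rfl
  | cons c y T => congrArg (cons c y) (join_lastBranch_dot T)

end Append

-- The product: locality, unit, Rota–Baxter identity, associativity

section Product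

variable {k X : Type*} [CommRing k] (lam : k)

/-- The product of two branches, which is the product of the trees that have them as their only
branch. -/
noncomputable def branchMul : AngBranch X → AngBranch X → AngBranch X →₀ k
  | .leaf, b => Finsupp.single b 1
  | .edge S, .leaf => Finsupp.single (.edge S) 1
  | .edge S, .edge S' => Finsupp.mapDomain .edge
      (diamond lam S.graft S' + diamond lam S S'.graft + lam • diamond lam S S')

/-- Only the two branches that meet interact; the rest of both trees is carried along by `join`.
This locality replaces the case split in all later arguments. -/
theorem diamond_eq_mapDomain_branchMul (T T' : AngTree X) :
    diamond lam T T' = Finsupp.mapDomain (fun b => join T b T')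
      (branchMul lam T.lastBranch T'.firstBranch) := by
  rw [diamond]
  split
  · rename_i h; rw [h, branchMul, Finsupp.mapDomain_single]
  · rename_i h h'; rw [h, h', branchMul, Finsupp.mapDomain_single]
  · rename_i h h'; rw [h, h', branchMul, ← Finsupp.mapDomain_comp]; rfl

theorem diamond_append_left (T : AngTree X) (x : X) (U V : AngTree X) :
    diamond lam (append T x U) V = Finsupp.mapDomain (append T x) (diamond lam U V) := by
  rw [diamond_eq_mapDomain_branchMul, diamond_eq_mapDomain_branchMul, ← Finsupp.mapDomain_comp,
    lastBranch_append]
  exact congrArg (fun g => Finsupp.mapDomain g _)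
    (funext fun b => join_append_left T x U b V)

theorem diamond_append_right (T U : AngTree X) (x : X) (V : AngTree X) :
    diamond lam T (append U x V) =
      Finsupp.mapDomain (fun W => append W x V) (diamond lam T U) := by
  rw [diamond_eq_mapDomain_branchMul, diamond_eq_mapDomain_branchMul, ← Finsupp.mapDomain_comp,
    firstBranch_append]
  exact congrArg (fun g => Finsupp.mapDomain g _)
    (funext fun b => join_append_right T b U x V)

theorem diamond_dot_left (T : AngTree X) : diamond lam dot T = Finsupp.single T 1 := by
  rw [diamond_eq_mapDomain_branchMul]
  simp [dot, lastBranch, branchMul, join, setFirst_firstBranch]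

theorem diamond_dot_right (T : AngTree X) : diamond lam T dot = Finsupp.single T 1 := by
  rw [diamond_eq_mapDomain_branchMul]
  have h : branchMul lam T.lastBranch (dot : AngTree X).firstBranch
      = Finsupp.single T.lastBranch 1 := by
    cases T.lastBranch <;> rfl
  rw [h, Finsupp.mapDomain_single, join_lastBranch_dot]

/-- With one branch on each side `join` adds nothing, so the recursive clause of the product is
itself the Rota–Baxter identity. -/
theorem diamond_graft_graft (S S' : AngTree X) :
    diamond lam S.graft S'.graft = Finsupp.mapDomain graft
      (diamond lam S.graft S' + diamond lam S S'.graft + lam • diamond lam S S') := by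
  rw [diamond_eq_mapDomain_branchMul]
  simp only [graft, lastBranch, firstBranch, branchMul]
  rw [← Finsupp.mapDomain_comp]
  rfl

theorem mulHom_single (T T' : AngTree X) :
    mulHom X lam (Finsupp.single T 1) (Finsupp.single T' 1) = diamond lam T T' := by
  simp [mulHom]

theorem graftHom_single (T : AngTree X) :
    graftHom k X (Finsupp.single T 1) = Finsupp.single T.graft 1 := by
  simp [graftHom]

/-- The bilinear extension of `append`. -/
noncomputable def appendHom (k : Type*) [CommRing k] {X : Type*} (x : X) :
    (AngTree X →₀ k) →ₗ[k] (AngTree X →₀ k) →ₗ[k] (AngTree X →₀ k) :=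
  Finsupp.linearCombination k fun T : AngTree X => Finsupp.lmapDomain k k (append T x)

theorem appendHom_single_left (x : X) (T : AngTree X) (a : AngTree X →₀ k) :
    appendHom k x (Finsupp.single T 1) a = Finsupp.mapDomain (append T x) a := by
  simp [appendHom]

theorem appendHom_single_right (x : X) (a : AngTree X →₀ k) (V : AngTree X) :
    appendHom k x a (Finsupp.single V 1) = Finsupp.mapDomain (fun W => append W x V) a := by
  have h : (appendHom k x).flip (Finsupp.single V 1)
      = Finsupp.lmapDomain k k (fun W => append W x V) := by
    ext W : 2
    simp [appendHom]
  exact LinearMap.congr_fun h a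

theorem appendHom_single (x : X) (T U : AngTree X) :
    appendHom k x (Finsupp.single T 1) (Finsupp.single U 1)
      = Finsupp.single (append T x U) 1 := by
  rw [appendHom_single_left, Finsupp.mapDomain_single]

theorem single_cons (b : AngBranch X) (x : X) (T : AngTree X) :
    (Finsupp.single (cons b x T) 1 : AngTree X →₀ k)
      = appendHom k x (Finsupp.single (last b) 1) (Finsupp.single T 1) :=
  (appendHom_single x (last b) T).symm

/-- For bilinear maps on `k 𝒯(X)`, an identity in the shape of associativity holds if it holds on
trees. -/
theorem mixed_assoc_of_single {p q r s : (AngTree X →₀ k) →ₗ[k] (AngTree X →₀ k) →ₗ[k]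
      (AngTree X →₀ k)}
    (h : ∀ T U V : AngTree X,
      p (q (Finsupp.single T 1) (Finsupp.single U 1)) (Finsupp.single V 1)
        = r (Finsupp.single T 1) (s (Finsupp.single U 1) (Finsupp.single V 1)))
    (a b c : AngTree X →₀ k) : p (q a b) c = r a (s b c) := by
  -- Both sides are curried into trilinear maps, which can be compared on basis elements.
  have key : q.compr₂ p = ((LinearMap.llcomp k _ _ _).comp r).compl₂ s :=
    Finsupp.lhom_ext' fun T => LinearMap.ext_ring <| Finsupp.lhom_ext' fun U =>
      LinearMap.ext_ring <| Finsupp.lhom_ext' fun V => LinearMap.ext_ring (h T U V)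
  exact LinearMap.congr_fun (LinearMap.congr_fun (LinearMap.congr_fun key a) b) c

/-- Linear maps on `k 𝒯(X)` in two variables agree if they agree on trees. -/
theorem bilinear_ext {M : Type*} [AddCommGroup M] [Module k M]
    {F G : (AngTree X →₀ k) →ₗ[k] (AngTree X →₀ k) →ₗ[k] M}
    (h : ∀ T U : AngTree X, F (Finsupp.single T 1) (Finsupp.single U 1)
      = G (Finsupp.single T 1) (Finsupp.single U 1)) : F = G :=
  Finsupp.lhom_ext' fun T => LinearMap.ext_ring <| Finsupp.lhom_ext' fun U =>
    LinearMap.ext_ring (h T U)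

theorem mulHom_appendHom_left (x : X) (a b c : AngTree X →₀ k) :
    mulHom X lam (appendHom k x a b) c = appendHom k x a (mulHom X lam b c) :=
  mixed_assoc_of_single (fun T U V => by
    rw [appendHom_single, mulHom_single, mulHom_single, diamond_append_left,
      appendHom_single_left]) a b c

theorem mulHom_appendHom_right (x : X) (a b c : AngTree X →₀ k) :
    mulHom X lam a (appendHom k x b c) = appendHom k x (mulHom X lam a b) c :=
  (mixed_assoc_of_single (fun T U V => by
    rw [appendHom_single, mulHom_single, mulHom_single, diamond_append_right,
      appendHom_single_right]) a b c).symm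

theorem mulHom_unit_left (a : AngTree X →₀ k) : mulHom X lam (unit k X) a = a := by
  have h : mulHom X lam (unit k X) = LinearMap.id :=
    Finsupp.lhom_ext' fun T => LinearMap.ext_ring <| by
      simpa [unit, mulHom_single] using diamond_dot_left lam T
  exact LinearMap.congr_fun h a

theorem mulHom_unit_right (a : AngTree X →₀ k) : mulHom X lam a (unit k X) = a := by
  have h : (mulHom X lam).flip (unit k X) = LinearMap.id :=
    Finsupp.lhom_ext' fun T => LinearMap.ext_ring <| by
      simpa [unit, mulHom_single] using diamond_dot_right lam T
  exact LinearMap.congr_fun h a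

theorem isRotaBaxterOperator_graftHom :
    IsRotaBaxterOperator lam (mulHom X lam) (graftHom k X) := by
  intro a b
  have h : (mulHom X lam).compl₁₂ (graftHom k X) (graftHom k X)
      = ((mulHom X lam).comp (graftHom k X) + (mulHom X lam).compl₂ (graftHom k X)
          + lam • mulHom X lam).compr₂ (graftHom k X) := by
    refine bilinear_ext fun T U => ?_
    simp only [LinearMap.compl₁₂_apply, LinearMap.compr₂_apply, LinearMap.add_apply,
      LinearMap.comp_apply, LinearMap.compl₂_apply, LinearMap.smul_apply, graftHom_single,
      mulHom_single, diamond_graft_graft]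
    rfl
  exact LinearMap.congr_fun (LinearMap.congr_fun h a) b

theorem sizeOf_pos (T : AngTree X) : 0 < sizeOf T := by
  cases T <;> simp

/-- Peeling off angles leaves three one-branch trees. A middle factor with an angle needs no
induction, since the two products then happen on opposite sides of that angle. -/
theorem mulHom_assoc_single : (T U V : AngTree X) →
    mulHom X lam (mulHom X lam (Finsupp.single T 1) (Finsupp.single U 1)) (Finsupp.single V 1)
      = mulHom X lam (Finsupp.single T 1)
          (mulHom X lam (Finsupp.single U 1) (Finsupp.single V 1))
  | cons b x T, U, V => by
      rw [single_cons, mulHom_appendHom_left, mulHom_appendHom_left, mulHom_appendHom_left,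
        mulHom_assoc_single T U V]
  | last b, cons c x U, V => by
      rw [single_cons, mulHom_appendHom_left, mulHom_appendHom_right, mulHom_appendHom_right,
        mulHom_appendHom_left]
  | last b, last c, cons d x V => by
      -- Needed for termination: `last d` is smaller than `cons d x V` because `V` has positive
      -- size.
      have hV := sizeOf_pos V
      rw [single_cons, mulHom_appendHom_right, mulHom_appendHom_right, mulHom_appendHom_right,
        mulHom_assoc_single (last b) (last c) (last d)]
  | last .leaf, last c, last d => by
      change mulHom X lam (mulHom X lam (unit k X) _) _ = mulHom X lam (unit k X) _
      rw [mulHom_unit_left, mulHom_unit_left]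
  | last (.edge _), last .leaf, last d => by
      change mulHom X lam (mulHom X lam _ (unit k X)) _
        = mulHom X lam _ (mulHom X lam (unit k X) _)
      rw [mulHom_unit_left, mulHom_unit_right]
  | last (.edge _), last (.edge _), last .leaf => by
      change mulHom X lam _ (unit k X) = mulHom X lam _ (mulHom X lam _ (unit k X))
      rw [mulHom_unit_right, mulHom_unit_right]
  | last (.edge T), last (.edge U), last (.edge V) => by
      -- One instance for each nonempty set of factors from which `B⁺` is stripped.
      have h₁ := mulHom_assoc_single (last (.edge T)) (last (.edge U)) V
      have h₂ := mulHom_assoc_single (last (.edge T)) U (last (.edge V))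
      have h₃ := mulHom_assoc_single T (last (.edge U)) (last (.edge V))
      have h₄ := mulHom_assoc_single (last (.edge T)) U V
      have h₅ := mulHom_assoc_single T (last (.edge U)) V
      have h₆ := mulHom_assoc_single T U (last (.edge V))
      have h₇ := mulHom_assoc_single T U V
      have hg : ∀ S : AngTree X, (Finsupp.single (last (.edge S)) 1 : AngTree X →₀ k)
          = graftHom k X (Finsupp.single S 1) := fun S => (graftHom_single S).symm
      simp only [hg] at *
      have hrb := isRotaBaxterOperator_graftHom (X := X) lam
      -- The products of two grafts inside `h₁` and `h₃` are expanded to match the terms that appear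
      -- when the goal is expanded twice on each side.
      rw [hrb] at h₁
      rw [hrb (Finsupp.single U 1)] at h₃
      rw [hrb, hrb, hrb (Finsupp.single U 1), hrb]
      refine congrArg (graftHom k X) ?_
      rw [h₁, ← h₃]
      simp only [map_add, map_smul, LinearMap.add_apply, LinearMap.smul_apply, smul_add,
        h₂, h₄, h₅, h₆, h₇]
      abel
termination_by T U V => sizeOf T + sizeOf U + sizeOf V

theorem mulHom_assoc (a b c : AngTree X →₀ k) :
    mulHom X lam (mulHom X lam a b) c = mulHom X lam a (mulHom X lam b c) :=
  mixed_assoc_of_single (mulHom_assoc_single lam) a b c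

theorem mulHom_mulHom_gen (x : X) (a b : AngTree X →₀ k) :
    mulHom X lam (mulHom X lam a (gen k x)) b = appendHom k x a b := by
  -- The corolla is two copies of `•` joined by the angle `x`.
  have h : gen k x = appendHom k x (unit k X) (unit k X) :=
    single_cons .leaf x (last .leaf)
  rw [h, mulHom_appendHom_right, mulHom_appendHom_left, mulHom_unit_right, mulHom_unit_left]

end Product

-- The universal property

section Lift

variable {k X R : Type*} [CommRing k] [Ring R] [Algebra k R]

mutual

/-- The value of a tree in an algebra with an operator `Q` that stands for grafting, where the
angle decorations are evaluated by `f`. -/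
def eval (Q : R →ₗ[k] R) (f : X → R) : AngTree X → R
  | last b => evalBranch Q f b
  | cons b x T => evalBranch Q f b * f x * eval Q f T

/-- The value of a branch, see `AngTree.eval`. -/
def evalBranch (Q : R →ₗ[k] R) (f : X → R) : AngBranch X → R
  | .leaf => 1
  | .edge T => Q (eval Q f T)

end

/-- The linear extension of `eval`. -/
noncomputable def lift (Q : R →ₗ[k] R) (f : X → R) : (AngTree X →₀ k) →ₗ[k] R :=
  Finsupp.linearCombination k (eval Q f)

variable (Q : R →ₗ[k] R) (f : X → R)

theorem lift_single (T : AngTree X) : lift Q f (Finsupp.single T 1) = eval Q f T := by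
  simp [lift]

theorem lift_unit : lift Q f (unit k X) = 1 := by
  simp [unit, lift_single, dot, eval, evalBranch]

theorem lift_gen (x : X) : lift Q f (gen k x) = f x := by
  simp [gen, lift_single, corolla, eval, evalBranch]

theorem lift_graftHom (a : AngTree X →₀ k) : lift Q f (graftHom k X a) = Q (lift Q f a) := by
  have h : (lift Q f).comp (graftHom k X) = Q.comp (lift Q f) :=
    Finsupp.lhom_ext' fun T => LinearMap.ext_ring <| by
      simp [graftHom_single, lift_single, graft, eval, evalBranch]
  exact LinearMap.congr_fun h a

theorem eval_append (T : AngTree X) (x : X) (U : AngTree X) :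
    eval Q f (append T x U) = eval Q f T * f x * eval Q f U :=
  match T with
  | last _ => by simp [append, eval]
  | cons _ _ T => by simp [append, eval, eval_append T x U, mul_assoc]

theorem lift_appendHom (x : X) (a b : AngTree X →₀ k) :
    lift Q f (appendHom k x a b) = lift Q f a * f x * lift Q f b := by
  have h : (appendHom k x).compr₂ (lift Q f)
      = (LinearMap.mul k R).compl₁₂ ((LinearMap.mulRight k (f x)).comp (lift Q f))
          (lift Q f) := by
    refine bilinear_ext fun T U => ?_
    simp [appendHom_single, lift_single, eval_append]
  exact LinearMap.congr_fun (LinearMap.congr_fun h a) b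

variable {lam : k} {Q}

/-- The reduction is that of associativity; for two grafts, the identity for `B⁺` is carried by
`lift` to the identity `hQ` for `Q`. -/
theorem lift_mulHom_single (hQ : IsRotaBaxterOperator lam (LinearMap.mul k R) Q) :
    (T U : AngTree X) →
    lift Q f (mulHom X lam (Finsupp.single T 1) (Finsupp.single U 1))
      = lift Q f (Finsupp.single T 1) * lift Q f (Finsupp.single U 1)
  | cons b x T, U => by
      rw [single_cons, mulHom_appendHom_left, lift_appendHom, lift_appendHom,
        lift_mulHom_single hQ T U]
      simp only [mul_assoc]
  | last b, cons c x U => by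
      have hU := sizeOf_pos U
      rw [single_cons, mulHom_appendHom_right, lift_appendHom, lift_appendHom,
        lift_mulHom_single hQ (last b) (last c)]
      simp only [mul_assoc]
  | last .leaf, last c => by
      change lift Q f (mulHom X lam (unit k X) _) = lift Q f (unit k X) * _
      rw [mulHom_unit_left, lift_unit, one_mul]
  | last (.edge _), last .leaf => by
      change lift Q f (mulHom X lam _ (unit k X)) = _ * lift Q f (unit k X)
      rw [mulHom_unit_right, lift_unit, mul_one]
  | last (.edge T), last (.edge U) => by
      have h₁ := lift_mulHom_single hQ (last (.edge T)) U
      have h₂ := lift_mulHom_single hQ T (last (.edge U))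
      have h₃ := lift_mulHom_single hQ T U
      have hg : ∀ S : AngTree X, (Finsupp.single (last (.edge S)) 1 : AngTree X →₀ k)
          = graftHom k X (Finsupp.single S 1) := fun S => (graftHom_single S).symm
      simp only [hg] at *
      rw [isRotaBaxterOperator_graftHom]
      simp only [lift_graftHom, map_add, map_smul, h₁, h₂, h₃]
      simpa using (hQ (lift Q f (Finsupp.single T 1)) (lift Q f (Finsupp.single U 1))).symm
termination_by T U => sizeOf T + sizeOf U

theorem lift_mulHom (hQ : IsRotaBaxterOperator lam (LinearMap.mul k R) Q)
    (a b : AngTree X →₀ k) :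
    lift Q f (mulHom X lam a b) = lift Q f a * lift Q f b := by
  have h : (mulHom X lam).compr₂ (lift Q f)
      = (LinearMap.mul k R).compl₁₂ (lift Q f) (lift Q f) :=
    bilinear_ext fun T U => lift_mulHom_single f hQ T U
  exact LinearMap.congr_fun (LinearMap.congr_fun h a) b

/-- Uniqueness: unit, generators, grafting and products build every tree. -/
theorem hom_single_eq_eval {φ : (AngTree X →₀ k) →ₗ[k] R} (h_one : φ (unit k X) = 1)
    (h_mul : ∀ a b, φ (mulHom X lam a b) = φ a * φ b)
    (h_graft : ∀ a, φ (graftHom k X a) = Q (φ a)) (h_gen : ∀ x, φ (gen k x) = f x) :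
    (T : AngTree X) → φ (Finsupp.single T 1) = eval Q f T
  | last .leaf => by rw [eval, evalBranch, ← h_one]; rfl
  | last (.edge T) => by
      rw [eval, evalBranch, ← hom_single_eq_eval h_one h_mul h_graft h_gen T, ← h_graft,
        graftHom_single]
      rfl
  | cons b x T => by
      have hT := sizeOf_pos T
      rw [single_cons, ← mulHom_mulHom_gen lam, h_mul, h_mul, h_gen, eval,
        hom_single_eq_eval h_one h_mul h_graft h_gen (last b),
        hom_single_eq_eval h_one h_mul h_graft h_gen T, eval]
termination_by T => sizeOf T

end Lift

end AngTree

theorem mainTheorem2 {k : Type u} [CommRing k] (X : Type v) (lam : k) :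
    IsFreeRotaBaxterAlgebra.{u, v, w} lam (AngTree.mulHom X lam) (AngTree.unit k X)
      (AngTree.graftHom k X) (AngTree.gen k : X → (AngTree X →₀ k)) where
  mul_assoc := AngTree.mulHom_assoc lam
  one_mul := AngTree.mulHom_unit_left lam
  mul_one := AngTree.mulHom_unit_right lam
  rotaBaxter := AngTree.isRotaBaxterOperator_graftHom lam
  existsUnique_hom := by
    intro R _ _ Q hQ f
    refine ⟨AngTree.lift Q f, ⟨AngTree.lift_unit Q f, AngTree.lift_mulHom f hQ,
      AngTree.lift_graftHom Q f, AngTree.lift_gen Q f⟩, ?_⟩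
    rintro φ ⟨h_one, h_mul, h_graft, h_gen⟩
    refine Finsupp.lhom_ext' fun T => LinearMap.ext_ring ?_
    exact (AngTree.hom_single_eq_eval f h_one h_mul h_graft h_gen T).trans
      (AngTree.lift_single Q f T).symm
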